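/- Let $p$ be a prime, let $D$ be a division ring that is finite-dimensional over its center $C$, where $C$ has characteristic $p$, and let $\delta$ be a derivation of $D$. Put $F=\{a\in C:\delta(a)=0\}$, a field. Let $R=D[t;\delta]$ be the ring of differential polynomials $\sum a_it^i$ ($a_i\in D$) with $ta=at+\delta(a)$ for $a\in D$. Call a polynomial over $F$ a $p$-polynomial if it is an $F$-linear combination of the monomials $x^{p^i}$, $i\ge 0$. Assume that $\delta$ is algebraic with minimum $p$-polynomial $g$ of degree $p^e$, that is, $g=x^{p^e}+\gamma_1x^{p^{e-1}}+\dots+\gamma_ex\in F[x]$ is the monic $p$-polynomial of least degree such that $g(\delta)$ is an inner derivation of $D$. Let $c\in D$ satisfy $g(\delta)(a)=ca-ac$ for all $a\in D$ and $\delta(c)=0$ (so that $R$ has center $F[g(t)-c]$). For $f\in R$ let $\mathcal E(f)=\{q\in R: fq\in Rf\}/Rf$ be its eigenring, an $F$-algebra; $f$ is called a generalised A-polynomial if $\mathcal E(f)$ is a (finite-dimensional) central simple algebra over $F$. Let $f\in R$ and let $\hat h\in F[x]$ be the monic polynomial such that $h(t)=\hat h(g(t)-c)$ is the minimal central left multiple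 of $f$, i.e. a nonzero element of least degree among the central elements of $R$ that lie in $Rf$. Suppose that $\hat h$ is irreducible in $F[x]$. Then $f$ is a generalised A-polynomial if and only if $f$ right divides $g(t)-(b+c)$ for some $b\in F$ (that is, $g(t)-(b+c)\in Rf$). In particular, if $f$ is a generalised A-polynomial, then $\deg f\le p^e$. -/

import Mathlib

open Polynomial

noncomputable section

/-- A derivation of a (not necessarily commutative) ring: an additive map with
`δ (x * y) = x * δ y + δ x * y`. -/
structure RingDerivation (D : Type*) [Ring D] extends D →+ D where
  leibniz' : ∀ x y : D, toFun (x * y) = x * toFun y + toFun x * y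

namespace RingDerivation

section Ring

variable {D : Type*} [Ring D]

instance : FunLike (RingDerivation D) D D where
  coe δ := δ.toFun
  coe_injective δ₁ δ₂ h := by
    cases δ₁; cases δ₂; congr; exact DFunLike.coe_injective h

instance : AddMonoidHomClass (RingDerivation D) D D where
  map_add δ := δ.map_add'
  map_zero δ := δ.map_zero'

theorem leibniz (δ : RingDerivation D) (x y : D) : δ (x * y) = x * δ y + δ x * y :=
  δ.leibniz' x y

theorem map_one (δ : RingDerivation D) : δ 1 = 0 := by
  have h := δ.leibniz 1 1
  simpa using h

end Ring

variable {D : Type*} [DivisionRing D]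

/-- The field `F = C ∩ Const(δ)` of the elements of the center `C` of `D` that are
annihilated by `δ`. -/
def constField (δ : RingDerivation D) : Subfield D where
  carrier := {a | a ∈ Subring.center D ∧ δ a = 0}
  mul_mem' := by
    rintro a b ⟨ha, ha'⟩ ⟨hb, hb'⟩
    exact ⟨mul_mem ha hb, by rw [leibniz, ha', hb', mul_zero, zero_mul, add_zero]⟩
  one_mem' := ⟨one_mem _, δ.map_one⟩
  add_mem' := by
    rintro a b ⟨ha, ha'⟩ ⟨hb, hb'⟩
    exact ⟨add_mem ha hb, by rw [map_add, ha', hb', add_zero]⟩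
  zero_mem' := ⟨zero_mem _, map_zero δ⟩
  neg_mem' := by
    rintro a ⟨ha, ha'⟩
    exact ⟨neg_mem ha, by rw [map_neg, ha', neg_zero]⟩
  inv_mem' := by
    rintro a ⟨ha, ha'⟩
    refine ⟨Set.inv_mem_center ha, ?_⟩
    by_cases h0 : a = 0
    · simp [h0]
    · have h := δ.leibniz a a⁻¹
      rw [mul_inv_cancel₀ h0, δ.map_one, ha', zero_mul, add_zero] at h
      exact (mul_eq_zero.mp h.symm).resolve_left h0

theorem mem_constField (δ : RingDerivation D) (a : D) :
    a ∈ δ.constField ↔ a ∈ Subring.center D ∧ δ a = 0 := Iff.rfl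

theorem constField_comm (δ : RingDerivation D) (a : δ.constField) (x : D) :
    (a : D) * x = x * a := (Subring.mem_center_iff.mp a.2.1 x).symm

instance (δ : RingDerivation D) : Field δ.constField :=
  { (inferInstance : DivisionRing δ.constField) with
    mul_comm := fun a b => Subtype.ext (δ.constField_comm a b) }

/-- The derivation `δ` as an `F`-linear endomorphism of `D`. -/
def toEnd (δ : RingDerivation D) : Module.End δ.constField D where
  toFun := δ
  map_add' := map_add δ
  map_smul' a x := by
    change δ ((a : D) * x) = (a : D) * δ x
    rw [leibniz, a.2.2, zero_mul, add_zero]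

end RingDerivation

/-- A `p`-polynomial: a linear combination of the powers `x ^ (p ^ i)`, `i = 0, 1, 2, …`. -/
def IsPPolynomial {k : Type*} [Semiring k] (p : ℕ) (g : k[X]) : Prop :=
  ∀ n ∈ g.support, ∃ i : ℕ, n = p ^ i

/-- `φ` is the inner derivation `δ_c`, where `δ_c(a) = [c, a] = c * a - a * c`. -/
def IsInnerBy {D : Type*} [Ring D] (φ : D → D) (c : D) : Prop :=
  ∀ a : D, φ a = c * a - a * c

/-- `g` is the minimum `p`-polynomial of `δ`: the monic `p`-polynomial over `F = C ∩ Const(δ)`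
of least degree such that `g(δ)` is an inner derivation of `D`. -/
def IsMinPPolynomial {D : Type*} [DivisionRing D] (p : ℕ) (δ : RingDerivation D)
    (g : (δ.constField)[X]) : Prop :=
  g.Monic ∧ IsPPolynomial p g ∧ (∃ c : D, IsInnerBy (aeval δ.toEnd g) c) ∧
    ∀ g' : (δ.constField)[X], g'.Monic → IsPPolynomial p g' →
      (∃ c : D, IsInnerBy (aeval δ.toEnd g') c) → g.natDegree ≤ g'.natDegree

/-- The ring `R = D[t; δ]` of differential polynomials `∑ aᵢ tⁱ` (coefficients on the left).
The additive group is that of the ordinary polynomials, the multiplication is the one with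
`t * a = a * t + δ a`, defined below. -/
def DiffPoly {D : Type*} [Ring D] (_δ : RingDerivation D) : Type _ := D[X]

namespace DiffPoly

section Ring

variable {D : Type*} [Ring D] (δ : RingDerivation D)

instance : AddCommGroup (DiffPoly δ) := inferInstanceAs (AddCommGroup D[X])

/-- The coefficientwise action of `δ`: `∑ bⱼ tʲ ↦ ∑ δ(bⱼ) tʲ`. -/
def mapCoeff : D[X] →+ D[X] :=
  AddMonoidHom.mk' (fun q => q.sum fun j b => Polynomial.monomial j (δ b)) fun p q =>
    Polynomial.sum_add_index p q _ (by simp) (by simp)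

/-- Left multiplication by `t`: `∑ bⱼ tʲ ↦ ∑ (bⱼ tʲ⁺¹ + δ(bⱼ) tʲ)`. -/
def tMul : AddMonoid.End D[X] := AddMonoidHom.mulRight (Polynomial.X : D[X]) + mapCoeff δ

/-- Left multiplication by `a` in `D`: `∑ bⱼ tʲ ↦ ∑ a bⱼ tʲ`. -/
def cMul : D →+* AddMonoid.End D[X] := Module.toAddMonoidEnd D D[X]

/-- Left multiplication by `p = ∑ aᵢ tⁱ`: the operator `∑ aᵢ ∘ tⁱ`. -/
def lMul : D[X] →+ AddMonoid.End D[X] :=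
  AddMonoidHom.mk' (fun p => p.sum fun i a => cMul a * tMul δ ^ i)
    fun p q => Polynomial.sum_add_index p q _ (by simp) (by simp [add_mul])

theorem end_mul_apply (φ ψ : AddMonoid.End D[X]) (q : D[X]) : (φ * ψ) q = φ (ψ q) := rfl

theorem end_add_apply (φ ψ : AddMonoid.End D[X]) (q : D[X]) : (φ + ψ) q = φ q + ψ q := rfl

theorem cMul_apply (a : D) (q : D[X]) : cMul a q = a • q := rfl

theorem mapCoeff_monomial (n : ℕ) (a : D) :
    mapCoeff δ (Polynomial.monomial n a) = Polynomial.monomial n (δ a) :=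
  Polynomial.sum_monomial_index a (fun j b => Polynomial.monomial j (δ b)) (by simp)

theorem tMul_monomial (n : ℕ) (a : D) :
    tMul δ (Polynomial.monomial n a) =
      Polynomial.monomial (n + 1) a + Polynomial.monomial n (δ a) := by
  change Polynomial.monomial n a * Polynomial.X + mapCoeff δ (Polynomial.monomial n a) = _
  rw [mapCoeff_monomial, Polynomial.monomial_mul_X]

theorem tMul_pow_one (n : ℕ) : (tMul δ ^ n) (1 : D[X]) = Polynomial.monomial n 1 := by
  induction n with
  | zero => simp
  | succ n ih => rw [pow_succ', end_mul_apply, ih, tMul_monomial, δ.map_one, map_zero, add_zero]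

theorem lMul_monomial (n : ℕ) (a : D) :
    lMul δ (Polynomial.monomial n a) = cMul a * tMul δ ^ n :=
  Polynomial.sum_monomial_index a
    (fun i a => cMul a * tMul δ ^ i) (by simp)

theorem tMul_mul_smul (a : D) :
    tMul δ * cMul a =
      cMul a * tMul δ + cMul (δ a) := by
  refine DFunLike.ext _ _ fun q => ?_
  induction q using Polynomial.induction_on' with
  | add p q hp hq => rw [map_add, hp, hq, map_add]
  | monomial n b =>
    simp only [end_add_apply, end_mul_apply, cMul_apply, tMul_monomial,
      Polynomial.smul_monomial, smul_eq_mul, δ.leibniz, map_add, add_assoc]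

theorem lMul_smul (a : D) (q : D[X]) :
    lMul δ (a • q) = cMul a * lMul δ q := by
  induction q using Polynomial.induction_on' with
  | add p q hp hq => rw [smul_add, map_add, hp, hq, map_add, mul_add]
  | monomial n b => simp [Polynomial.smul_monomial, lMul_monomial, mul_assoc]

theorem lMul_tMul (q : D[X]) : lMul δ (tMul δ q) = tMul δ * lMul δ q := by
  induction q using Polynomial.induction_on' with
  | add p q hp hq => rw [map_add, map_add, hp, hq, map_add, mul_add]
  | monomial n b =>
    rw [tMul_monomial, map_add, lMul_monomial, lMul_monomial, lMul_monomial, ← mul_assoc,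
      tMul_mul_smul, add_mul, pow_succ', mul_assoc]

theorem lMul_lMul (p q : D[X]) : lMul δ (lMul δ p q) = lMul δ p * lMul δ q := by
  induction p using Polynomial.induction_on' with
  | add p₁ p₂ h₁ h₂ => rw [map_add, end_add_apply, map_add, h₁, h₂, add_mul]
  | monomial n a =>
    have h : ∀ r : D[X], lMul δ ((tMul δ ^ n) r) = tMul δ ^ n * lMul δ r := by
      induction n with
      | zero => intro r; simp
      | succ n ih =>
        intro r
        rw [pow_succ', end_mul_apply, lMul_tMul, ih, mul_assoc]
    rw [lMul_monomial, end_mul_apply, cMul_apply, lMul_smul, h,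
      mul_assoc]

theorem lMul_one : lMul δ 1 = 1 := by
  rw [← Polynomial.monomial_zero_one, lMul_monomial]; simp

theorem lMul_apply_one (p : D[X]) : lMul δ p 1 = p := by
  induction p using Polynomial.induction_on' with
  | add p q hp hq => rw [map_add, end_add_apply, hp, hq]
  | monomial n a =>
    rw [lMul_monomial, end_mul_apply, tMul_pow_one, cMul_apply,
      Polynomial.smul_monomial, smul_eq_mul, mul_one]

instance : Ring (DiffPoly δ) :=
  { (inferInstance : AddCommGroup (DiffPoly δ)) with
    mul := fun p q => lMul δ p q
    one := (1 : D[X])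
    mul_assoc := fun p q r => congrArg (fun φ : AddMonoid.End D[X] => φ r) (lMul_lMul δ p q)
    one_mul := fun p => congrArg (fun φ : AddMonoid.End D[X] => φ p) (lMul_one δ)
    mul_one := lMul_apply_one δ
    zero_mul := fun p => congrArg (fun φ : AddMonoid.End D[X] => φ p) (map_zero (lMul δ))
    mul_zero := fun p => map_zero (lMul δ p)
    left_distrib := fun p q r => map_add (lMul δ p) q r
    right_distrib := fun p q r =>
      congrArg (fun φ : AddMonoid.End D[X] => φ r) (map_add (lMul δ) p q) }

variable {δ}

/-- The degree, with value `⊥` (that is, `-∞`) at `0`. -/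
def degree (f : DiffPoly δ) : WithBot ℕ := Polynomial.degree (R := D) f

variable (δ)

/-- The indeterminate `t`. -/
def t : DiffPoly δ := (Polynomial.X : D[X])

/-- The inclusion of `D` into `D[t; δ]` as the constant polynomials. -/
def C : D →+* DiffPoly δ where
  toFun a := (Polynomial.C a : D[X])
  map_one' := Polynomial.C_1
  map_zero' := Polynomial.C_0
  map_add' _ _ := Polynomial.C_add
  map_mul' a b := by
    change (Polynomial.C (a * b) : D[X]) = lMul δ (Polynomial.C a) (Polynomial.C b)
    rw [← Polynomial.monomial_zero_left, ← Polynomial.monomial_zero_left,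
      ← Polynomial.monomial_zero_left, lMul_monomial, pow_zero, mul_one,
      cMul_apply, Polynomial.smul_monomial, smul_eq_mul]

/-- The defining relation of `D[t; δ]`. -/
theorem t_mul_C (a : D) : t δ * C δ a = C δ a * t δ + C δ (δ a) := by
  change lMul δ Polynomial.X (Polynomial.C a) =
    lMul δ (Polynomial.C a) Polynomial.X + (Polynomial.C (δ a) : D[X])
  rw [← Polynomial.monomial_zero_left, ← Polynomial.monomial_zero_left,
    ← Polynomial.monomial_one_one_eq_X, lMul_monomial, lMul_monomial, pow_zero, pow_one, mul_one,
    end_mul_apply, tMul_monomial, cMul_apply,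
    cMul_apply, one_smul, Polynomial.smul_monomial, smul_eq_mul, mul_one]

theorem C_mul_t_pow (a : D) (n : ℕ) : C δ a * t δ ^ n = (Polynomial.monomial n a : D[X]) := by
  have h : ∀ n : ℕ, t δ ^ n = (Polynomial.monomial n 1 : D[X]) := by
    intro n
    induction n with
    | zero => rfl
    | succ n ih =>
      rw [pow_succ', ih]
      change lMul δ Polynomial.X (Polynomial.monomial n 1) = _
      rw [← Polynomial.monomial_one_one_eq_X, lMul_monomial, pow_one, end_mul_apply,
        tMul_monomial, δ.map_one, map_zero, add_zero, cMul_apply, one_smul]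
  rw [h]
  change lMul δ (Polynomial.C a) (Polynomial.monomial n 1) = _
  rw [← Polynomial.monomial_zero_left, lMul_monomial, pow_zero, mul_one,
    cMul_apply, Polynomial.smul_monomial, smul_eq_mul, mul_one]

end Ring

variable {D : Type*} [DivisionRing D] (δ : RingDerivation D)

/-- Every element of `F = C ∩ Const(δ)` is central in `D[t; δ]`. -/
theorem C_constField_comm (a : δ.constField) (q : DiffPoly δ) :
    C δ (a : D) * q = q * C δ (a : D) := by
  change lMul δ (Polynomial.C (a : D)) q = lMul δ q (Polynomial.C (a : D))
  have h : ∀ n : ℕ, (tMul δ ^ n) (Polynomial.monomial 0 (a : D)) =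
      Polynomial.monomial n (a : D) := by
    intro n
    induction n with
    | zero => rfl
    | succ n ih =>
      rw [pow_succ', end_mul_apply, ih, tMul_monomial, a.2.2, map_zero, add_zero]
  rw [← Polynomial.monomial_zero_left]
  refine Polynomial.induction_on' (motive := fun q : D[X] =>
    lMul δ (Polynomial.monomial 0 (a : D)) q = lMul δ q (Polynomial.monomial 0 (a : D)))
    q ?_ ?_
  · intro p q hp hq
    rw [map_add, map_add, end_add_apply, hp, hq]
  · intro n b
    rw [lMul_monomial, lMul_monomial, end_mul_apply, end_mul_apply, h, pow_zero,
      AddMonoid.End.coe_one, id_eq, cMul_apply, cMul_apply,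
      Polynomial.smul_monomial, Polynomial.smul_monomial, smul_eq_mul, smul_eq_mul,
      δ.constField_comm a b]

/-- `D[t; δ]` as an algebra over `F = C ∩ Const(δ)`. -/
instance : Algebra δ.constField (DiffPoly δ) :=
  ((C δ).comp δ.constField.subtype).toAlgebra' (C_constField_comm δ)

end DiffPoly

/-- The idealiser `{g ∈ R | f g ∈ R f}` of `f` in the `k`-algebra `R`. -/
def idealiser (k : Type*) {R : Type*} [CommRing k] [Ring R] [Algebra k R] (f : R) :
    Subalgebra k R where
  carrier := {g | f ∣ᵣ f * g}
  mul_mem' := by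
    rintro x y ⟨q, hq⟩ ⟨r, hr⟩
    exact ⟨q * r, by rw [← mul_assoc, hq, mul_assoc, hr, mul_assoc]⟩
  add_mem' := by
    rintro x y ⟨q, hq⟩ ⟨r, hr⟩
    exact ⟨q + r, by rw [mul_add, hq, hr, add_mul]⟩
  algebraMap_mem' a := ⟨algebraMap k R a, (Algebra.commutes a f).symm⟩

/-- `R f` as an ideal of the idealiser of `f`. -/
def idealiserIdeal (k : Type*) {R : Type*} [CommRing k] [Ring R] [Algebra k R] (f : R) :
    Ideal (idealiser k f) where
  carrier := {g | f ∣ᵣ (g : R)}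
  add_mem' := by
    rintro x y ⟨q, hq⟩ ⟨r, hr⟩
    exact ⟨q + r, by rw [Subalgebra.coe_add, hq, hr, add_mul]⟩
  zero_mem' := ⟨0, by simp⟩
  smul_mem' := by
    rintro x y ⟨q, hq⟩
    exact ⟨x * q, by rw [smul_eq_mul, Subalgebra.coe_mul, hq, mul_assoc]⟩

instance (k : Type*) {R : Type*} [CommRing k] [Ring R] [Algebra k R] (f : R) :
    (idealiserIdeal k f).IsTwoSided where
  mul_mem_of_left := by
    rintro x y ⟨q, hq⟩
    obtain ⟨r, hr⟩ := y.2
    exact ⟨q * r, by rw [Subalgebra.coe_mul, hq, mul_assoc, hr, mul_assoc]⟩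

/-- The eigenring of `f`: the quotient of the idealiser of `f` by `R f`. -/
abbrev Eigenring (k : Type*) {R : Type*} [CommRing k] [Ring R] [Algebra k R] (f : R) : Type _ :=
  idealiser k f ⧸ idealiserIdeal k f

/-- `f` is a generalised A-polynomial: its eigenring is a (finite-dimensional) central simple
algebra over `F = C ∩ Const(δ)`. -/
def IsGeneralisedAPolynomial {D : Type*} [DivisionRing D] {δ : RingDerivation D}
    (f : DiffPoly δ) : Prop :=
  IsSimpleRing (Eigenring δ.constField f) ∧
    Algebra.IsCentral δ.constField (Eigenring δ.constField f) ∧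
    Module.Finite δ.constField (Eigenring δ.constField f)

/-- `h` is a central left multiple of `f`, nonzero and of minimal degree as such. -/
def IsMinimalCentralLeftMultiple {D : Type*} [Ring D] {δ : RingDerivation D}
    (f h : DiffPoly δ) : Prop :=
  h ≠ 0 ∧ h ∈ Subring.center (DiffPoly δ) ∧ f ∣ᵣ h ∧
    ∀ h' : DiffPoly δ, h' ≠ 0 → h' ∈ Subring.center (DiffPoly δ) → f ∣ᵣ h' →
      h.degree ≤ h'.degree

end

/-
Put `z = g(t) - c`, a central element of `R`. If the eigenring of `f` is central over `F`, then the
class of `z` in it is some `b ∈ F`, that is, `f` right divides `z - b`.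

Conversely, suppose that `f` right divides the central element `w = z - b`. A nonzero two-sided
ideal of `R` contains a central element of least degree, and by minimality of `g` the central
elements of degree less than `deg g` lie in `F`. Hence `R / Rw` is simple with center `F`. It is
finite-dimensional, because `δ` satisfies `g` on the center `C` of `D` and therefore `C` is finite
over its constants `F`. So the left ideal that `f` generates in `R / Rw` is the annihilator of an
idempotent `e`, and the eigenring of `f` is the corner `e (R / Rw) e`, which is again central
simple over `F`.
-/

noncomputable section

theorem exists_sum_mul_mul_eq_one {S : Type*} [Ring S] [IsSimpleRing S] {w : S} (hw : w ≠ 0) :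
    ∃ (n : ℕ) (x y : Fin n → S), ∑ i, x i * w * y i = 1 := by
  have h1 : (1 : S) ∈ TwoSidedIdeal.span {w} :=
    IsSimpleRing.one_mem_of_ne_zero_mem _ hw (TwoSidedIdeal.subset_span rfl)
  rw [TwoSidedIdeal.mem_span_iff_mem_addSubgroup_closure,
    ← Submodule.span_int_eq_addSubgroupClosure] at h1
  obtain ⟨n, z, v, hv⟩ := Submodule.mem_span_set'.mp h1
  have hv' (i : Fin n) : ∃ a b : S, a * w * b = v i := by
    obtain ⟨-, ⟨a, -, w', rfl, rfl⟩, b, -, hb⟩ := (v i).2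
    exact ⟨a, b, hb⟩
  choose a b hab using hv'
  refine ⟨n, fun i => z i • a i, b, ?_⟩
  simp_rw [smul_mul_assoc, hab, hv]

section Corner

variable {S : Type*} [Ring S] {e : S} {he : IsIdempotentElem e}

theorem idem_mul_corner (x : he.Corner) : e * x.1 = x.1 := congrArg Subtype.val (one_mul x)

theorem corner_mul_idem (x : he.Corner) : x.1 * e = x.1 := congrArg Subtype.val (mul_one x)

/-- The corner `e S e` of a `k`-algebra `S` as a `k`-algebra with unit `e`. -/
instance {k : Type*} [CommRing k] [Algebra k S] : Algebra k he.Corner where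
  smul r x := ⟨r • x.1, r • x.1, by
    simp only [mul_smul_comm, smul_mul_assoc, idem_mul_corner, corner_mul_idem]⟩
  algebraMap :=
    { toFun r := ⟨r • e, r • e, by simp only [mul_smul_comm, smul_mul_assoc, he.eq]⟩
      map_one' := Subtype.ext (one_smul k e)
      map_mul' r s := Subtype.ext <| by
        change (r * s) • e = r • e * s • e
        rw [smul_mul_smul_comm, he.eq]
      map_zero' := Subtype.ext (zero_smul k e)
      map_add' r s := Subtype.ext (add_smul r s e) }
  commutes' r x := Subtype.ext <| by
    change r • e * x.1 = x.1 * r • e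
    rw [smul_mul_assoc, mul_smul_comm, idem_mul_corner, corner_mul_idem]
  smul_def' r x := Subtype.ext <| by
    change r • x.1 = r • e * x.1
    rw [smul_mul_assoc, idem_mul_corner]

variable (he) in
/-- The compression `s ↦ e s e` of `S` onto its corner `e S e`. -/
def cornerCompress : S →+ he.Corner where
  toFun s := ⟨e * s * e, s, rfl⟩
  map_zero' := Subtype.ext <| by
    change e * 0 * e = 0
    rw [mul_zero, zero_mul]
  map_add' s t := Subtype.ext <| by
    change e * (s + t) * e = e * s * e + e * t * e
    rw [mul_add, add_mul]

theorem cornerCompress_surjective : Function.Surjective (cornerCompress he) := by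
  rintro ⟨-, s, rfl⟩
  exact ⟨s, rfl⟩

theorem cornerCompress_one : cornerCompress he 1 = 1 := Subtype.ext <| by
  change e * 1 * e = e
  rw [mul_one, he.eq]

theorem cornerCompress_smul {k : Type*} [CommRing k] [Algebra k S] (r : k) (s : S) :
    cornerCompress he (r • s) = r • cornerCompress he s := Subtype.ext <| by
  change e * r • s * e = r • (e * s * e)
  rw [mul_smul_comm, smul_mul_assoc]

theorem cornerCompress_mul_mul (s t : S) (x : he.Corner) :
    cornerCompress he (s * x.1 * t) = cornerCompress he s * x * cornerCompress he t :=
  Subtype.ext <| by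
    change e * (s * x.1 * t) * e = e * s * e * x.1 * (e * t * e)
    calc e * (s * x.1 * t) * e = e * s * (e * x.1 * e) * t * e := by
          rw [idem_mul_corner, corner_mul_idem]; noncomm_ring
      _ = e * s * e * x.1 * (e * t * e) := by noncomm_ring

theorem isSimpleRing_corner [IsSimpleRing S] (h0 : e ≠ 0) : IsSimpleRing he.Corner := by
  have : Nontrivial he.Corner := ⟨1, 0, fun h => h0 (congrArg Subtype.val h)⟩
  refine IsSimpleRing.of_eq_bot_or_eq_top fun T => or_iff_not_imp_left.mpr fun hT => ?_
  obtain ⟨a, haT, ha⟩ := SetLike.exists_of_lt (bot_lt_iff_ne_bot.mpr hT)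
  have ha' : a.1 ≠ 0 := fun h => ha (Subtype.ext h)
  obtain ⟨n, x, y, hxy⟩ := exists_sum_mul_mul_eq_one ha'
  rw [← TwoSidedIdeal.one_mem_iff, ← cornerCompress_one, ← hxy, map_sum]
  refine sum_mem fun i _ => ?_
  rw [cornerCompress_mul_mul]
  exact T.mul_mem_right _ _ (T.mul_mem_left _ _ haT)

-- The central lift of `a` is `∑ xᵢ a yᵢ`, where `1 = ∑ xᵢ e yᵢ`.
theorem exists_mem_center_cornerCompress_eq [IsSimpleRing S] (h0 : e ≠ 0) {a : he.Corner}
    (ha : a ∈ Subring.center he.Corner) : ∃ l ∈ Subring.center S, cornerCompress he l = a := by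
  have hcomm (w : S) : e * w * a.1 = a.1 * w * e := by
    have h := congrArg Subtype.val (Subring.mem_center_iff.mp ha (cornerCompress he w))
    change e * w * e * a.1 = a.1 * (e * w * e) at h
    rwa [mul_assoc _ e, idem_mul_corner, ← mul_assoc, ← mul_assoc, corner_mul_idem] at h
  obtain ⟨n, x, y, hxy⟩ := exists_sum_mul_mul_eq_one h0
  refine ⟨∑ i, x i * a.1 * y i, Subring.mem_center_iff.mpr fun s => ?_, ?_⟩
  · have hswap (i j : Fin n) : x j * e * y j * s * (x i * a.1 * y i) =
        x j * a.1 * y j * s * (x i * e * y i) :=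
      calc _ = x j * (e * (y j * s * x i) * a.1) * y i := by noncomm_ring
        _ = _ := by rw [hcomm]; noncomm_ring
    calc s * ∑ i, x i * a.1 * y i = (∑ j, x j * e * y j) * s * ∑ i, x i * a.1 * y i := by
          rw [hxy, one_mul]
      _ = (∑ j, x j * a.1 * y j) * s * ∑ i, x i * e * y i := by
        simp only [Finset.sum_mul, Finset.mul_sum, hswap]
      _ = (∑ i, x i * a.1 * y i) * s := by rw [hxy, mul_one]
  · calc cornerCompress he (∑ i, x i * a.1 * y i)
        = ∑ i, cornerCompress he (x i) * a * cornerCompress he (y i) := by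
          simp_rw [map_sum, cornerCompress_mul_mul]
      _ = a * ∑ i, cornerCompress he (x i) * 1 * cornerCompress he (y i) := by
          simp_rw [Finset.mul_sum, Subring.mem_center_iff.mp ha, mul_one, mul_assoc]
      _ = a * cornerCompress he (∑ i, x i * e * y i) := by
          rw [map_sum]
          exact congrArg _ (Finset.sum_congr rfl fun i _ => (cornerCompress_mul_mul _ _ 1).symm)
      _ = a := by rw [hxy, cornerCompress_one, mul_one]

theorem isCentral_corner {k : Type*} [CommRing k] [Algebra k S] [IsSimpleRing S]
    [Algebra.IsCentral k S] (h0 : e ≠ 0) : Algebra.IsCentral k he.Corner where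
  out a ha := by
    obtain ⟨l, hl, rfl⟩ := exists_mem_center_cornerCompress_eq h0
      (Subring.mem_center_iff.mpr (Subalgebra.mem_center_iff.mp ha))
    obtain ⟨r, rfl⟩ := Algebra.IsCentral.out (K := k)
      (Subalgebra.mem_center_iff.mpr (Subring.mem_center_iff.mp hl))
    refine ⟨r, ?_⟩
    change algebraMap k he.Corner r = cornerCompress he (algebraMap k S r)
    rw [Algebra.algebraMap_eq_smul_one, Algebra.algebraMap_eq_smul_one, cornerCompress_smul,
      cornerCompress_one]

theorem finite_corner {k : Type*} [CommRing k] [Algebra k S] [Module.Finite k S] :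
    Module.Finite k he.Corner :=
  let c : S →ₗ[k] he.Corner := { cornerCompress he with map_smul' := cornerCompress_smul }
  .of_surjective c cornerCompress_surjective

end Corner

section Eigenring

variable {k R S : Type*} [CommRing k] [Ring R] [Algebra k R] [Ring S] [Algebra k S]
  (φ : R →ₐ[k] S) {f : R} {e : S} (he : IsIdempotentElem e) (hf : ∀ q, f ∣ᵣ q ↔ φ q * e = 0)

include he hf in
theorem idem_mul_map_mul_idem (hφ : Function.Surjective φ) {q : R} (hq : q ∈ idealiser k f) :
    e * φ q * e = φ q * e := by
  obtain ⟨r, hr⟩ := hφ (1 - e)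
  obtain ⟨s, rfl⟩ : f ∣ᵣ r := (hf r).mpr (by rw [hr, he.one_sub_mul_self])
  have h : φ (f * q) * e = 0 := (hf _).mp hq
  have : (1 - e) * φ q * e = 0 := by
    rw [← hr, map_mul, mul_assoc, mul_assoc, ← mul_assoc (φ f), ← map_mul, h, mul_zero]
  rwa [sub_mul, sub_mul, one_mul, sub_eq_zero, eq_comm] at this

/-- The map `q ↦ φ(q) e` from the idealiser of `f` to the corner `e S e`, when
`R f = {q | φ(q) e = 0}`. -/
def idealiserToCorner (hφ : Function.Surjective φ) : idealiser k f →ₐ[k] he.Corner where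
  toFun q := ⟨φ q * e, φ q * e, by
    simp only [← mul_assoc, idem_mul_map_mul_idem φ he hf hφ q.2]
    rw [mul_assoc, he.eq]⟩
  map_one' := Subtype.ext <| by
    change φ 1 * e = e
    rw [map_one, one_mul]
  map_mul' q r := Subtype.ext <| by
    change φ (q * r) * e = φ q * e * (φ r * e)
    rw [map_mul, mul_assoc, mul_assoc, ← mul_assoc e, idem_mul_map_mul_idem φ he hf hφ r.2]
  map_zero' := Subtype.ext <| by
    change φ 0 * e = 0
    rw [map_zero, zero_mul]
  map_add' q r := Subtype.ext <| by
    change φ (q + r) * e = φ q * e + φ r * e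
    rw [map_add, add_mul]
  commutes' a := Subtype.ext <| by
    change φ (algebraMap k R a) * e = a • e
    rw [AlgHom.commutes, Algebra.smul_def]

theorem idealiserToCorner_surjective (hφ : Function.Surjective φ) :
    Function.Surjective (idealiserToCorner φ he hf hφ) := by
  intro x
  obtain ⟨q, hq⟩ := hφ x.1
  have hqe : φ q * e = x.1 := by rw [hq, corner_mul_idem]
  refine ⟨⟨q, (hf _).mpr ?_⟩, Subtype.ext hqe⟩
  rw [map_mul, mul_assoc, hqe, ← idem_mul_corner, ← mul_assoc, (hf f).mp (.refl f), zero_mul]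

theorem ker_idealiserToCorner (hφ : Function.Surjective φ) :
    RingHom.ker (idealiserToCorner φ he hf hφ) = idealiserIdeal k f :=
  Ideal.ext fun q => Subtype.ext_iff.trans (hf q).symm

/-- The eigenring of `f` is the corner `e S e`, when `R f = {q | φ(q) e = 0}`. -/
def eigenringEquivCorner (hφ : Function.Surjective φ) : Eigenring k f ≃ₐ[k] he.Corner :=
  (Ideal.quotientEquivAlgOfEq k (ker_idealiserToCorner φ he hf hφ).symm).trans
    (Ideal.quotientKerAlgEquivOfSurjective (idealiserToCorner_surjective φ he hf hφ))

theorem exists_idempotent_rightDvd_iff [IsSemisimpleRing S] (hφ : Function.Surjective φ)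
    (hker : ∀ q, φ q = 0 → f ∣ᵣ q) :
    ∃ e : S, IsIdempotentElem e ∧ ∀ q, f ∣ᵣ q ↔ φ q * e = 0 := by
  obtain ⟨e', he', hspan⟩ := IsSemisimpleRing.ideal_eq_span_idempotent (Ideal.span {φ f})
  have hmem (s : S) : s * (1 - e') = 0 ↔ ∃ r, r * φ f = s := by
    rw [← Ideal.mem_span_singleton', hspan, Ideal.mem_span_singleton', mul_sub, mul_one,
      sub_eq_zero]
    exact ⟨fun h => ⟨s, h.symm⟩, fun ⟨r, h⟩ => by rw [← h, mul_assoc, he'.eq]⟩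
  refine ⟨1 - e', he'.one_sub, fun q => Iff.trans ?_ (hmem (φ q)).symm⟩
  refine ⟨fun ⟨r, h⟩ => ⟨φ r, by rw [h, map_mul]⟩, fun ⟨s, hs⟩ => ?_⟩
  obtain ⟨r, rfl⟩ := hφ s
  obtain ⟨u, hu⟩ := hker (q - r * f) (by rw [map_sub, map_mul, hs, sub_self])
  exact ⟨u + r, by rw [add_mul, ← hu, sub_add_cancel]⟩

theorem isSimpleRing_isCentral_finite_eigenring [IsSimpleRing S] [Algebra.IsCentral k S]
    [IsSemisimpleRing S] [Module.Finite k S] (hφ : Function.Surjective φ)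
    (hker : ∀ q, φ q = 0 → f ∣ᵣ q) (h1 : ¬ f ∣ᵣ 1) :
    IsSimpleRing (Eigenring k f) ∧ Algebra.IsCentral k (Eigenring k f) ∧
      Module.Finite k (Eigenring k f) := by
  obtain ⟨e, he, hf⟩ := exists_idempotent_rightDvd_iff φ hφ hker
  have h0 : e ≠ 0 := fun h => h1 ((hf 1).mpr (by rw [h, mul_zero]))
  have := isSimpleRing_corner (he := he) h0
  have := isCentral_corner (k := k) (he := he) h0
  have := finite_corner (k := k) (he := he)
  let E := eigenringEquivCorner φ he hf hφ
  refine ⟨.of_ringEquiv E.symm.toRingEquiv ‹_›, ⟨fun x hx => ?_⟩, .equiv E.symm.toLinearEquiv⟩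
  have hEx : E x ∈ Subalgebra.center k he.Corner := Subalgebra.mem_center_iff.mpr fun y => by
    simpa only [map_mul, E.apply_symm_apply] using
      congrArg E (Subalgebra.mem_center_iff.mp hx (E.symm y))
  obtain ⟨r, hr⟩ := Algebra.IsCentral.out hEx
  exact ⟨r, E.injective ((E.commutes r).trans hr)⟩

end Eigenring

section PPolynomial

variable {p : ℕ} [Fact p.Prime]

theorem exists_not_dvd_choose {n : ℕ} (hn : n ≠ 0) (h : ∀ i, n ≠ p ^ i) :
    ∃ j, 0 < j ∧ j < n ∧ ¬ p ∣ n.choose j := by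
  have hp : p.Prime := Fact.out
  induction n using Nat.strong_induction_on with
  | _ n ih =>
    by_cases hpn : p ∣ n
    · obtain ⟨m, rfl⟩ := hpn
      have hm : 0 < m := Nat.pos_of_ne_zero (right_ne_zero_of_mul hn)
      obtain ⟨j, hj, hjm, hc⟩ := ih m (lt_mul_left hm hp.one_lt) hm.ne' fun i hi =>
        h (i + 1) (by rw [hi, pow_succ'])
      refine ⟨p * j, Nat.mul_pos hp.pos hj, Nat.mul_lt_mul_of_pos_left hjm hp.pos, ?_⟩
      rwa [Choose.choose_mul_mul_modEq_choose_nat.dvd_iff dvd_rfl]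
    · have h1 : n ≠ 1 := by simpa only [pow_zero] using h 0
      exact ⟨1, one_pos, by lia, by rwa [Nat.choose_one_right]⟩

theorem isPPolynomial_iff {k : Type*} [Semiring k] [NoZeroDivisors k] [CharP k p] {g : k[X]} :
    IsPPolynomial p g ↔ g.coeff 0 = 0 ∧ ∀ j ≠ 0, hasseDeriv j g = C (g.coeff j) := by
  have hp : p.Prime := Fact.out
  constructor
  · refine fun hg => ⟨?_, fun j hj => Polynomial.ext fun n => ?_⟩
    · by_contra h
      obtain ⟨i, hi⟩ := hg 0 (mem_support_iff.mpr h)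
      exact pow_ne_zero i hp.ne_zero hi.symm
    rw [hasseDeriv_coeff, coeff_C]
    split_ifs with hn
    · rw [hn, zero_add, Nat.choose_self, Nat.cast_one, one_mul]
    by_cases h : g.coeff (n + j) = 0
    · rw [h, mul_zero]
    obtain ⟨i, hi⟩ := hg _ (mem_support_iff.mpr h)
    rw [(CharP.cast_eq_zero_iff k p _).mpr, zero_mul]
    exact hi ▸ hp.dvd_choose_pow hj (by lia)
  · rintro ⟨h0, hg⟩ n hn
    by_contra! hpow
    rw [mem_support_iff] at hn
    obtain ⟨j, hj, hjn, hc⟩ := exists_not_dvd_choose (p := p) (by rintro rfl; exact hn h0) hpow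
    have h : (hasseDeriv j g).coeff (n - j) = 0 := by
      rw [hg j hj.ne', coeff_C_of_ne_zero (Nat.sub_ne_zero_of_lt hjn)]
    rw [hasseDeriv_coeff, Nat.sub_add_cancel hjn.le, mul_eq_zero,
      CharP.cast_eq_zero_iff k p] at h
    exact h.elim hc hn

end PPolynomial

section Derivation

variable {F K : Type*} [Field F] [Field K] [Algebra F K]

/-- The jet `(a, d a, d² a, …)` of `a` under a derivation `d`; linear dependence of jets over `K`
plays the role of a vanishing Wronskian. -/
def jet (d : Derivation F K K) (a : K) (n : ℕ) : K := ((d : Module.End F K) ^ n) a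

theorem derivation_jet (d : Derivation F K K) (a : K) (n : ℕ) :
    d (jet d a n) = jet d a (n + 1) := by
  rw [jet, jet, pow_succ', Module.End.mul_apply]
  rfl

theorem derivation_eq_zero_of_sum_smul_jet {d : Derivation F K K} {ι : Type*} [Fintype ι]
    {b : ι → K} (hb : LinearIndependent K fun i => jet d (b i)) {x : ι → K} {a : K}
    (ha : ∑ i, x i • jet d (b i) = jet d a) (i : ι) : d (x i) = 0 := by
  refine Fintype.linearIndependent_iff.mp hb (fun i => d (x i)) (funext fun n => ?_) i
  have hn (n : ℕ) : ∑ i, x i * jet d (b i) n = jet d a n := by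
    simpa only [Finset.sum_apply, Pi.smul_apply, smul_eq_mul] using congrFun ha n
  have h := derivation_jet d a n
  rw [← hn, ← hn, map_sum] at h
  simp only [d.leibniz, smul_eq_mul, derivation_jet, Finset.sum_add_distrib] at h
  simpa only [Finset.sum_apply, Pi.smul_apply, smul_eq_mul, mul_comm, Pi.zero_apply] using
    left_eq_add.mp h.symm

theorem finiteDimensional_span_range_jet {d : Derivation F K K}
    (hd : IsIntegral F (d : Module.End F K)) :
    FiniteDimensional K (Submodule.span K (Set.range (jet d))) := by
  obtain ⟨g, hg, hgd⟩ := hd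
  let E : LinearRecurrence K := ⟨g.natDegree, fun i => -algebraMap F K (g.coeff i)⟩
  have : FiniteDimensional K E.solSpace := .equiv E.toInit.symm
  refine Submodule.finiteDimensional_of_le (S₂ := E.solSpace) (Submodule.span_le.mpr ?_)
  rintro - ⟨a, rfl⟩ n
  have h := LinearMap.congr_fun hgd (jet d a n)
  change aeval (d : Module.End F K) g _ = 0 at h
  have hjet (i : ℕ) : ((d : Module.End F K) ^ i) (jet d a n) = jet d a (n + i) := by
    rw [jet, jet, add_comm, pow_add, Module.End.mul_apply]
  rw [aeval_eq_sum_range, Finset.sum_range_succ, hg.coeff_natDegree, one_smul, LinearMap.add_apply,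
    LinearMap.sum_apply, ← Fin.sum_univ_eq_sum_range
      (fun i => (g.coeff i • (d : Module.End F K) ^ i) (jet d a n))] at h
  simp only [LinearMap.smul_apply, hjet] at h
  simp only [Algebra.smul_def] at h
  simpa only [E, neg_mul, Finset.sum_neg_distrib] using eq_neg_of_add_eq_zero_right h

theorem finite_of_isIntegral_derivation {d : Derivation F K K}
    (hconst : ∀ x, d x = 0 → x ∈ (algebraMap F K).range)
    (hd : IsIntegral F (d : Module.End F K)) : Module.Finite F K := by
  have := finiteDimensional_span_range_jet hd
  obtain ⟨j, hj, hspan, hli⟩ := Submodule.exists_fun_fin_finrank_span_eq K (Set.range (jet d))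
  choose b hb using hj
  obtain rfl : (fun i => jet d (b i)) = j := funext hb
  refine Module.Finite.of_surjective (Fintype.linearCombination F b) fun a => ?_
  have ha : jet d a ∈ Submodule.span K (Set.range fun i => jet d (b i)) :=
    hspan.ge (Submodule.subset_span ⟨a, rfl⟩)
  obtain ⟨x, hx⟩ := (Submodule.mem_span_range_iff_exists_fun K).mp ha
  choose y hy using fun i => hconst (x i) (derivation_eq_zero_of_sum_smul_jet hli hx i)
  refine ⟨y, ?_⟩
  have h0 : ∑ i, x i * b i = a := by
    simpa only [Finset.sum_apply, Pi.smul_apply, smul_eq_mul, jet, pow_zero,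
      Module.End.one_apply] using congrFun hx 0
  simp only [Fintype.linearCombination_apply, Algebra.smul_def, hy, h0]

end Derivation

namespace RingDerivation

theorem map_mem_center {D : Type*} [Ring D] {δ : RingDerivation D} {a : D}
    (ha : a ∈ Subring.center D) : δ a ∈ Subring.center D := by
  rw [Subring.mem_center_iff] at ha ⊢
  refine fun x => add_left_cancel (a := δ x * a) ?_
  rw [add_comm, ← δ.leibniz, ha, δ.leibniz, ha, add_comm]

variable {D : Type*} [DivisionRing D] {δ : RingDerivation D}

instance : Algebra δ.constField (Subring.center D) :=
  (Subring.inclusion (S := δ.constField.toSubring) fun _ ha => ha.1).toAlgebra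

instance : IsScalarTower δ.constField (Subring.center D) D :=
  ⟨fun a x y => mul_assoc (a : D) x y⟩

instance (p : ℕ) [CharP (Subring.center D) p] : CharP δ.constField p :=
  (algebraMap δ.constField (Subring.center D)).charP
    (fun _ _ h => Subtype.ext (congrArg (Subtype.val (p := (· ∈ Subring.center D))) h)) p

variable (δ) in
/-- The restriction of `δ` to the center of `D`, a derivation over the field `F`. It is
used to show that the center is finite over `F`. -/
def restrictCenter : Derivation δ.constField (Subring.center D) (Subring.center D) :=
  Derivation.mk'
    { toFun a := ⟨δ a, map_mem_center a.2⟩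
      map_add' a b := Subtype.ext (map_add δ (a : D) b)
      map_smul' a b := Subtype.ext (δ.toEnd.map_smul a (b : D)) }
    fun a b => Subtype.ext <| (δ.leibniz a b).trans <|
      congrArg _ (Subring.mem_center_iff.mp b.2 _)

theorem coe_aeval_restrictCenter (g : (δ.constField)[X]) (a : Subring.center D) :
    (aeval (δ.restrictCenter : Module.End δ.constField (Subring.center D)) g a : D) =
      aeval δ.toEnd g (a : D) := by
  induction g using Polynomial.induction_on generalizing a with
  | C r => rw [aeval_C, aeval_C]; rfl
  | add p q hp hq => simp only [map_add, LinearMap.add_apply, Subring.coe_add, hp, hq]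
  | monomial n r h =>
    rw [pow_succ, ← mul_assoc, map_mul, map_mul (aeval δ.toEnd), aeval_X, aeval_X,
      Module.End.mul_apply, Module.End.mul_apply, h]
    rfl

theorem finite_of_isInnerBy [Module.Finite (Subring.center D) D] {g : (δ.constField)[X]}
    (hg : g.Monic) {c : D} (hc : IsInnerBy (aeval δ.toEnd g) c) :
    Module.Finite δ.constField D := by
  have : Module.Finite δ.constField (Subring.center D) := by
    refine finite_of_isIntegral_derivation (d := δ.restrictCenter)
      (fun x hx => ⟨⟨x, x.2, congrArg Subtype.val hx⟩, rfl⟩)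
      ⟨g, hg, LinearMap.ext fun a => Subtype.ext ?_⟩
    refine (coe_aeval_restrictCenter g a).trans ((hc a).trans ?_)
    rw [Subring.mem_center_iff.mp a.2, sub_self]
    rfl
  exact .trans (Subring.center D) D

end RingDerivation

namespace DiffPoly

section Ring

variable {D : Type*} [Ring D] {δ : RingDerivation D}

/-- The coefficient of `tⁿ`. -/
def coeff (n : ℕ) : DiffPoly δ →+ D := (Polynomial.lcoeff D n).toAddMonoidHom

theorem ext_coeff {p q : DiffPoly δ} (h : ∀ n, coeff n p = coeff n q) : p = q :=
  Polynomial.ext (R := D) h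

theorem coeff_C (a : D) (n : ℕ) : coeff n (C δ a) = if n = 0 then a else 0 :=
  Polynomial.coeff_C

theorem coeff_C_zero (a : D) : coeff 0 (C δ a) = a :=
  Polynomial.coeff_C_zero

theorem coeff_C_of_ne_zero (a : D) {n : ℕ} (hn : n ≠ 0) : coeff n (C δ a) = 0 :=
  Polynomial.coeff_C_of_ne_zero hn

theorem lMul_X (q : D[X]) : lMul δ q X = q * X := by
  induction q using Polynomial.induction_on' with
  | add p q hp hq => rw [map_add, end_add_apply, hp, hq, add_mul]
  | monomial n a =>
    have hX : (X : D[X]) = (tMul δ ^ 1) 1 := by rw [tMul_pow_one, monomial_one_one_eq_X]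
    rw [monomial_mul_X, lMul_monomial, hX, ← end_mul_apply, mul_assoc, ← pow_add,
      end_mul_apply, tMul_pow_one, cMul_apply, smul_monomial, smul_eq_mul, mul_one]

theorem coeff_mul_t_zero (q : DiffPoly δ) : coeff 0 (q * t δ) = 0 :=
  (congrArg (Polynomial.coeff · 0) (lMul_X q)).trans (Polynomial.coeff_mul_X_zero (R := D) q)

theorem coeff_mul_t_succ (q : DiffPoly δ) (n : ℕ) : coeff (n + 1) (q * t δ) = coeff n q :=
  (congrArg (Polynomial.coeff · (n + 1)) (lMul_X q)).trans (Polynomial.coeff_mul_X (R := D) q n)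

theorem exists_eq_mul_t_add_C (q : DiffPoly δ) : ∃ p, q = p * t δ + C δ (coeff 0 q) := by
  obtain ⟨p, hp⟩ : ∃ p : DiffPoly δ, ∀ n, coeff n p = coeff (n + 1) q :=
    ⟨Polynomial.divX (R := D) q, fun _ => Polynomial.coeff_divX (R := D) (p := q)⟩
  refine ⟨p, ext_coeff fun n => ?_⟩
  rw [map_add]
  cases n with
  | zero => rw [coeff_mul_t_zero, coeff_C_zero, zero_add]
  | succ n => rw [coeff_mul_t_succ, coeff_C_of_ne_zero _ n.succ_ne_zero, add_zero, hp]

@[elab_as_elim]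
theorem induction_on {motive : DiffPoly δ → Prop} (q : DiffPoly δ)
    (C : ∀ a, motive (C δ a)) (add : ∀ p q, motive p → motive q → motive (p + q))
    (mul_t : ∀ q, motive q → motive (q * t δ)) : motive q := by
  refine Polynomial.induction_on' (R := D) (motive := motive) q add fun n a => ?_
  rw [← C_mul_t_pow]
  induction n with
  | zero => simpa only [pow_zero, mul_one] using C a
  | succ n ih => simpa only [pow_succ, mul_assoc] using mul_t _ ih

theorem coeff_C_mul (a : D) (q : DiffPoly δ) (n : ℕ) : coeff n (C δ a * q) = a * coeff n q := by
  induction q using induction_on generalizing n with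
  | C b => simp only [← map_mul, coeff_C, mul_ite, mul_zero]
  | add p q hp hq => rw [mul_add, map_add, hp, hq, map_add, mul_add]
  | mul_t q hq =>
    rw [← mul_assoc]
    cases n with
    | zero => rw [coeff_mul_t_zero, coeff_mul_t_zero, mul_zero]
    | succ n => rw [coeff_mul_t_succ, coeff_mul_t_succ, hq]

theorem coeff_t_mul_sub_mul_t (q : DiffPoly δ) (n : ℕ) :
    coeff n (t δ * q - q * t δ) = δ (coeff n q) := by
  induction q using induction_on generalizing n with
  | C a =>
    rw [t_mul_C, add_sub_cancel_left, coeff_C, coeff_C]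
    split_ifs
    exacts [rfl, (map_zero δ).symm]
  | add p q hp hq => rw [mul_add, add_mul, add_sub_add_comm, map_add, hp, hq, map_add, map_add]
  | mul_t q hq =>
    rw [← mul_assoc, ← sub_mul]
    cases n with
    | zero => rw [coeff_mul_t_zero, coeff_mul_t_zero, map_zero]
    | succ n => rw [coeff_mul_t_succ, coeff_mul_t_succ, hq]

theorem t_mul_eq_mul_t_iff {q : DiffPoly δ} : t δ * q = q * t δ ↔ ∀ n, δ (coeff n q) = 0 := by
  simp_rw [← coeff_t_mul_sub_mul_t, ← sub_eq_zero (a := t δ * q)]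
  exact ⟨fun h n => by rw [h, map_zero], fun h => ext_coeff fun n => (h n).trans (map_zero _).symm⟩

theorem coeff_zero_t_mul (q : DiffPoly δ) : coeff 0 (t δ * q) = δ (coeff 0 q) := by
  rw [← coeff_t_mul_sub_mul_t, map_sub, coeff_mul_t_zero, sub_zero]

theorem coeff_succ_t_mul (q : DiffPoly δ) (n : ℕ) :
    coeff (n + 1) (t δ * q) = coeff n q + δ (coeff (n + 1) q) := by
  rw [← coeff_t_mul_sub_mul_t, map_sub, coeff_mul_t_succ, add_sub_cancel]

theorem mem_center_iff {q : DiffPoly δ} :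
    q ∈ Subring.center (DiffPoly δ) ↔ (∀ a, C δ a * q = q * C δ a) ∧ t δ * q = q * t δ := by
  rw [Subring.mem_center_iff]
  refine ⟨fun h => ⟨fun a => h _, h _⟩, fun ⟨hC, ht⟩ r => ?_⟩
  induction r using induction_on with
  | C a => exact hC a
  | add r s hr hs => rw [add_mul, mul_add, hr, hs]
  | mul_t r hr => rw [mul_assoc, ht, ← mul_assoc, hr, mul_assoc]

theorem degree_lt_iff_coeff_zero {q : DiffPoly δ} {n : ℕ} :
    degree q < n ↔ ∀ i, n ≤ i → coeff i q = 0 :=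
  Polynomial.degree_lt_iff_coeff_zero (R := D) q n

theorem degree_le_iff_coeff_zero {q : DiffPoly δ} {n : ℕ} :
    degree q ≤ n ↔ ∀ i, n < i → coeff i q = 0 :=
  (Polynomial.degree_le_iff_coeff_zero (R := D) q n).trans <| by simp only [Nat.cast_lt]; rfl

theorem degree_lt_of_le_of_coeff_eq_zero {q : DiffPoly δ} {n : ℕ} (h : degree q ≤ n)
    (hn : coeff n q = 0) : degree q < n :=
  degree_lt_iff_coeff_zero.mpr fun _ hi =>
    hi.eq_or_lt.elim (· ▸ hn) (degree_le_iff_coeff_zero.mp h _)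

theorem degree_eq_of_le_of_coeff_ne_zero {q : DiffPoly δ} {n : ℕ} (h : degree q ≤ n)
    (hn : coeff n q ≠ 0) : degree q = n :=
  h.antisymm (Polynomial.le_degree_of_ne_zero (R := D) hn)

theorem exists_degree_eq {q : DiffPoly δ} (hq : q ≠ 0) : ∃ n : ℕ, degree q = n ∧ coeff n q ≠ 0 :=
  ⟨Polynomial.natDegree (R := D) q, Polynomial.degree_eq_natDegree (R := D) hq,
    fun h => hq (Polynomial.leadingCoeff_eq_zero (R := D).mp h)⟩

theorem degree_eq_bot {q : DiffPoly δ} : degree q = ⊥ ↔ q = 0 := Polynomial.degree_eq_bot (R := D)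

theorem ne_zero_of_degree_pos {q : DiffPoly δ} (hq : 0 < degree q) : q ≠ 0 :=
  Polynomial.ne_zero_of_degree_gt (R := D) hq

theorem degree_sub_le (p q : DiffPoly δ) : degree (p - q) ≤ max (degree p) (degree q) :=
  Polynomial.degree_sub_le (R := D) p q

theorem degree_C_le (a : D) : degree (C δ a) ≤ 0 := Polynomial.degree_C_le

theorem degree_one_le : degree (1 : DiffPoly δ) ≤ 0 := Polynomial.degree_one_le (R := D)

theorem eq_C_of_degree_le_zero {q : DiffPoly δ} (h : degree q ≤ 0) : q = C δ (coeff 0 q) :=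
  Polynomial.eq_C_of_degree_le_zero (R := D) h

theorem degree_t_mul_le {q : DiffPoly δ} {n : ℕ} (hq : degree q ≤ n) :
    degree (t δ * q) ≤ (n + 1 : ℕ) := by
  rw [degree_le_iff_coeff_zero] at hq ⊢
  rintro (_ | i) hi
  · exact absurd hi (Nat.not_lt_zero _)
  · rw [coeff_succ_t_mul, hq i (by lia), hq (i + 1) (by lia), map_zero, add_zero]

theorem degree_mul_le_and_coeff_mul {p q : DiffPoly δ} {m n : ℕ} (hp : degree p ≤ m)
    (hq : degree q ≤ n) :
    degree (p * q) ≤ (m + n : ℕ) ∧ coeff (m + n) (p * q) = coeff m p * coeff n q := by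
  induction m generalizing p q n with
  | zero =>
    rw [eq_C_of_degree_le_zero hp, coeff_C_mul, coeff_C_zero, zero_add]
    refine ⟨degree_le_iff_coeff_zero.mpr fun i hi => ?_, rfl⟩
    rw [coeff_C_mul, degree_le_iff_coeff_zero.mp hq i hi, mul_zero]
  | succ m ih =>
    obtain ⟨r, hr⟩ := exists_eq_mul_t_add_C p
    have hcoeff (i : ℕ) : coeff (i + 1) p = coeff i r := by
      rw [hr, map_add, coeff_mul_t_succ, coeff_C_of_ne_zero _ i.succ_ne_zero, add_zero]
    have hrm : degree r ≤ m := degree_le_iff_coeff_zero.mpr fun i hi => by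
      rw [← hcoeff, degree_le_iff_coeff_zero.mp hp _ (by lia)]
    have hqi := degree_le_iff_coeff_zero.mp hq
    obtain ⟨hle, hc⟩ := ih hrm (degree_t_mul_le hq)
    have hpq (i : ℕ) (hi : n < i) : coeff i (p * q) = coeff i (r * (t δ * q)) := by
      conv_lhs => rw [hr]
      rw [add_mul, map_add, coeff_C_mul, hqi i hi, mul_zero, add_zero, mul_assoc]
    rw [hpq _ (by lia), Nat.add_right_comm, Nat.add_assoc, hc, hcoeff, coeff_succ_t_mul,
      hqi _ n.lt_succ_self, map_zero, add_zero]
    refine ⟨degree_le_iff_coeff_zero.mpr fun i hi => ?_, rfl⟩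
    rw [hpq i (by lia), degree_le_iff_coeff_zero.mp hle i hi]

theorem degree_mul_le_of_le {p q : DiffPoly δ} {m n : ℕ} (hp : degree p ≤ m) (hq : degree q ≤ n) :
    degree (p * q) ≤ (m + n : ℕ) :=
  (degree_mul_le_and_coeff_mul hp hq).1

theorem coeff_mul_of_degree_le {p q : DiffPoly δ} {m n : ℕ} (hp : degree p ≤ m)
    (hq : degree q ≤ n) : coeff (m + n) (p * q) = coeff m p * coeff n q :=
  (degree_mul_le_and_coeff_mul hp hq).2

theorem degree_mul [NoZeroDivisors D] (p q : DiffPoly δ) :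
    degree (p * q) = degree p + degree q := by
  by_cases hp : p = 0
  · rw [hp, zero_mul, degree_eq_bot.mpr rfl, WithBot.bot_add]
  by_cases hq : q = 0
  · rw [hq, mul_zero, degree_eq_bot.mpr rfl, WithBot.add_bot]
  obtain ⟨m, hm, hm0⟩ := exists_degree_eq hp
  obtain ⟨n, hn, hn0⟩ := exists_degree_eq hq
  rw [hm, hn, ← Nat.cast_add]
  refine degree_eq_of_le_of_coeff_ne_zero (degree_mul_le_of_le hm.le hn.le) ?_
  rw [coeff_mul_of_degree_le hm.le hn.le]
  exact mul_ne_zero hm0 hn0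

instance [Nontrivial D] : Nontrivial (DiffPoly δ) := inferInstanceAs (Nontrivial D[X])

instance [NoZeroDivisors D] : NoZeroDivisors (DiffPoly δ) where
  eq_zero_or_eq_zero_of_mul_eq_zero {p q} h := by
    rwa [← degree_eq_bot, degree_mul, WithBot.add_eq_bot, degree_eq_bot, degree_eq_bot] at h

theorem degree_le_of_rightDvd [NoZeroDivisors D] {f q : DiffPoly δ} (hq : q ≠ 0) (h : f ∣ᵣ q) :
    degree f ≤ degree q := by
  obtain ⟨s, rfl⟩ := h
  obtain ⟨n, hn, -⟩ := exists_degree_eq (left_ne_zero_of_mul hq)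
  rw [degree_mul, hn]
  exact le_add_of_nonneg_left (Nat.cast_nonneg n)

theorem degree_C_mul_sub_mul_C_le [NoZeroDivisors D] (a : D) (u : DiffPoly δ) :
    degree (C δ a * u - u * C δ a) ≤ degree u := by
  refine (degree_sub_le _ _).trans (max_le ?_ ?_) <;> rw [degree_mul]
  exacts [add_le_of_nonpos_left (degree_C_le a), add_le_of_nonpos_right (degree_C_le a)]

theorem degree_t_mul_sub_mul_t_le (u : DiffPoly δ) : degree (t δ * u - u * t δ) ≤ degree u :=
  (Polynomial.degree_le_iff_coeff_zero (R := D) _ _).mpr fun n hn => by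
    refine (coeff_t_mul_sub_mul_t u n).trans ?_
    rw [show coeff n u = 0 from Polynomial.coeff_eq_zero_of_degree_lt (R := D) hn, map_zero]

theorem eq_zero_of_mem_span_of_degree_lt [NoZeroDivisors D] {u z : DiffPoly δ}
    (hu : u ∈ Ideal.span {z}) (hdeg : degree u < degree z) : u = 0 := by
  obtain ⟨s, rfl⟩ := Ideal.mem_span_singleton'.mp hu
  by_contra h
  exact hdeg.not_ge (degree_le_of_rightDvd h (.mul_self z s))

theorem one_notMem_span [NoZeroDivisors D] [Nontrivial D] {z : DiffPoly δ} (hz : 0 < degree z) :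
    (1 : DiffPoly δ) ∉ Ideal.span {z} := fun h =>
  one_ne_zero (eq_zero_of_mem_span_of_degree_lt h (degree_one_le.trans_lt hz))

/-- The Hasse derivative `b tⁱ ↦ (i choose j) b tⁱ⁻ʲ` on `D[t; δ]`, which lowers the degree and
preserves the center. -/
def hasse (j : ℕ) : DiffPoly δ →+ DiffPoly δ :=
  (Polynomial.hasseDeriv (R := D) j).toAddMonoidHom

theorem coeff_hasse (j n : ℕ) (q : DiffPoly δ) :
    coeff n (hasse j q) = (n + j).choose j • coeff (n + j) q :=
  (Polynomial.hasseDeriv_coeff (R := D) j q n).trans (nsmul_eq_mul _ _).symm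

theorem coeff_zero_hasse (j : ℕ) (q : DiffPoly δ) : coeff 0 (hasse j q) = coeff j q := by
  rw [coeff_hasse, zero_add, Nat.choose_self, one_nsmul]

theorem hasse_zero (q : DiffPoly δ) : hasse 0 q = q :=
  ext_coeff fun n => by rw [coeff_hasse, Nat.choose_zero_right, one_nsmul, add_zero]

theorem hasse_C (a : D) {j : ℕ} (hj : j ≠ 0) : hasse j (C δ a) = 0 :=
  ext_coeff fun n => by
    rw [coeff_hasse, coeff_C_of_ne_zero _ (by lia), smul_zero, map_zero]

theorem hasse_C_mul (j : ℕ) (a : D) (q : DiffPoly δ) :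
    hasse j (C δ a * q) = C δ a * hasse j q :=
  ext_coeff fun n => by
    rw [coeff_hasse, coeff_C_mul, coeff_C_mul, coeff_hasse, mul_smul_comm]

theorem hasse_succ_mul_t (j : ℕ) (q : DiffPoly δ) :
    hasse (j + 1) (q * t δ) = hasse (j + 1) q * t δ + hasse j q := by
  refine ext_coeff fun n => ?_
  rw [map_add, coeff_hasse, coeff_hasse, ← add_assoc, coeff_mul_t_succ]
  cases n with
  | zero => rw [coeff_mul_t_zero, zero_add, zero_add, Nat.choose_self, Nat.choose_self]
  | succ n =>
    rw [coeff_mul_t_succ, coeff_hasse, Nat.choose_succ_succ, add_smul, add_comm,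
      Nat.add_right_comm n 1 j, add_assoc n j 1]

-- `(q t) a = (q a) t + q δ(a)` turns right multiplication by `a` into an induction on `q`.
theorem hasse_mul_C (j : ℕ) (q : DiffPoly δ) (a : D) :
    hasse j (q * C δ a) = hasse j q * C δ a := by
  cases j with
  | zero => rw [hasse_zero, hasse_zero]
  | succ j =>
    induction q using induction_on generalizing j a with
    | C b => rw [← map_mul, hasse_C _ j.succ_ne_zero, hasse_C _ j.succ_ne_zero, zero_mul]
    | add p q hp hq => rw [add_mul, map_add, map_add, hp, hq, add_mul]
    | mul_t q hq =>
      have hj : hasse j (q * C δ a) = hasse j q * C δ a := by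
        cases j with
        | zero => rw [hasse_zero, hasse_zero]
        | succ j => exact hq a j
      rw [mul_assoc, t_mul_C, mul_add, ← mul_assoc, map_add, hasse_succ_mul_t, hasse_succ_mul_t,
        hq, hq, hj, add_mul, mul_assoc _ (t δ), t_mul_C, mul_add, mul_assoc]
      abel

theorem hasse_mem_center (j : ℕ) {q : DiffPoly δ} (hq : q ∈ Subring.center (DiffPoly δ)) :
    hasse j q ∈ Subring.center (DiffPoly δ) := by
  rw [mem_center_iff, t_mul_eq_mul_t_iff] at hq ⊢
  refine ⟨fun a => by rw [← hasse_mul_C, ← hasse_C_mul, hq.1], fun n => ?_⟩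
  rw [coeff_hasse, map_nsmul, hq.2, smul_zero]

end Ring

end DiffPoly

namespace DiffPoly

section PPolynomial

variable {D : Type*} [DivisionRing D] {δ : RingDerivation D}

theorem algebraMap_eq (a : δ.constField) : algebraMap δ.constField (DiffPoly δ) a = C δ (a : D) :=
  rfl

theorem C_mem_center_iff {a : D} : C δ a ∈ Subring.center (DiffPoly δ) ↔ a ∈ δ.constField := by
  rw [mem_center_iff, t_mul_eq_mul_t_iff, RingDerivation.mem_constField, Subring.mem_center_iff]
  refine and_congr (forall_congr' fun b => ?_) ⟨fun h => ?_, fun h n => ?_⟩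
  · rw [← map_mul, ← map_mul]
    refine ⟨fun h => ?_, congrArg _⟩
    rw [← coeff_C_zero (δ := δ) (b * a), h, coeff_C_zero]
  · simpa only [coeff_C_zero] using h 0
  · rw [coeff_C, apply_ite δ, h, map_zero, ite_self]

theorem coeff_aeval_t (g : (δ.constField)[X]) (n : ℕ) :
    coeff n (aeval (t δ) g) = (g.coeff n : D) := by
  induction g using Polynomial.induction_on' with
  | add p q hp hq => rw [map_add, map_add, hp, hq, Polynomial.coeff_add]; rfl
  | monomial m b =>
    rw [aeval_monomial, algebraMap_eq, Polynomial.coeff_monomial, apply_ite Subtype.val]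
    exact (congrArg (Polynomial.coeff · n) (C_mul_t_pow δ (b : D) m)).trans
      Polynomial.coeff_monomial

theorem aeval_t_injective : Function.Injective (aeval (R := δ.constField) (t δ)) := fun p q h =>
  Polynomial.ext fun n => Subtype.ext <| by rw [← coeff_aeval_t, h, coeff_aeval_t]

theorem exists_eq_aeval_t_add_C {u : DiffPoly δ} (h : ∀ n ≠ 0, coeff n u ∈ δ.constField) :
    ∃ q : (δ.constField)[X], q.coeff 0 = 0 ∧ u = aeval (t δ) q + C δ (coeff 0 u) := by
  have hlift : (u - C δ (coeff 0 u) : DiffPoly δ) ∈ lifts δ.constField.subtype := by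
    refine (lifts_iff_coeff_lifts _).mpr fun n => ?_
    change coeff n (u - C δ (coeff 0 u)) ∈ _
    rw [map_sub]
    by_cases hn : n = 0
    · exact ⟨0, by rw [hn, coeff_C_zero, sub_self, map_zero]⟩
    · exact ⟨⟨_, h n hn⟩, by rw [coeff_C_of_ne_zero _ hn, sub_zero]; rfl⟩
  obtain ⟨q, hq⟩ := (mem_lifts _).mp hlift
  have hqu (n : ℕ) : (q.coeff n : D) = coeff n (u - C δ (coeff 0 u)) :=
    (Polynomial.coeff_map _ n).symm.trans (congrArg (Polynomial.coeff · n) hq)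
  refine ⟨q, Subtype.ext ?_, eq_add_of_sub_eq (ext_coeff fun n => ?_)⟩
  · rw [hqu, map_sub, coeff_C_zero, sub_self]; rfl
  · rw [coeff_aeval_t, hqu]

theorem hasse_aeval_t (j : ℕ) (g : (δ.constField)[X]) :
    hasse j (aeval (t δ) g) = aeval (t δ) (hasseDeriv j g) :=
  ext_coeff fun n => by
    rw [coeff_hasse, coeff_aeval_t, coeff_aeval_t, hasseDeriv_coeff, nsmul_eq_mul]
    push_cast
    rfl

theorem coeff_zero_aeval_t_mul_C (g : (δ.constField)[X]) (a : D) :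
    coeff 0 (aeval (t δ) g * C δ a) = aeval δ.toEnd g a := by
  induction g using Polynomial.induction_on with
  | C r => rw [aeval_C, aeval_C, algebraMap_eq, ← map_mul, coeff_C_zero]; rfl
  | add p q hp hq => rw [map_add, add_mul, map_add, hp, hq, map_add, LinearMap.add_apply]
  | monomial n r h =>
    rw [pow_succ, ← mul_assoc, ← X_mul, map_mul (aeval _), aeval_X, mul_assoc, coeff_zero_t_mul, h,
      map_mul (aeval δ.toEnd) X, aeval_X, Module.End.mul_apply]
    rfl

theorem isInnerBy_neg_of_mem_center {q : (δ.constField)[X]} (hq : q.coeff 0 = 0) {a : D}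
    (h : aeval (t δ) q + C δ a ∈ Subring.center (DiffPoly δ)) :
    IsInnerBy (aeval δ.toEnd q) (-a) := fun x => by
  have hx := congrArg (coeff 0) ((mem_center_iff.mp h).1 x)
  rw [coeff_C_mul, add_mul, map_add, map_add, coeff_zero_aeval_t_mul_C, coeff_aeval_t, hq,
    ← map_mul, coeff_C_zero, coeff_C_zero, ZeroMemClass.coe_zero, zero_add] at hx
  rw [eq_sub_of_add_eq hx.symm, neg_mul, mul_neg, sub_neg_eq_add, neg_add_eq_sub]

theorem _root_.IsMinPPolynomial.natDegree_le {p : ℕ} {g : (δ.constField)[X]}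
    (hg : IsMinPPolynomial p δ g) {q : (δ.constField)[X]} (hq : q ≠ 0) (hqp : IsPPolynomial p q)
    {c : D} (hc : IsInnerBy (aeval δ.toEnd q) c) : g.natDegree ≤ q.natDegree := by
  have hlc := leadingCoeff_ne_zero.mpr hq
  rw [← natDegree_C_mul (p := q) (inv_ne_zero hlc)]
  refine hg.2.2.2 _ (monic_C_mul_of_mul_leadingCoeff_eq_one (inv_mul_cancel₀ hlc))
    (fun n hn => hqp n ?_) ⟨(q.leadingCoeff⁻¹ : δ.constField) * c, fun x => ?_⟩
  · rw [mem_support_iff, Polynomial.coeff_C_mul] at hn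
    exact mem_support_iff.mpr (right_ne_zero_of_mul hn)
  · rw [← smul_eq_C_mul, map_smul, LinearMap.smul_apply, hc, ← mul_assoc x, ← δ.constField_comm,
      mul_assoc, mul_assoc, ← mul_sub]
    rfl

variable {p : ℕ} [Fact p.Prime] [CharP δ.constField p] {g : (δ.constField)[X]}

theorem aeval_t_mul_C (hg : IsPPolynomial p g) (a : D) :
    aeval (t δ) g * C δ a = C δ a * aeval (t δ) g + C δ (aeval δ.toEnd g a) := by
  obtain ⟨hg0, hgj⟩ := isPPolynomial_iff.mp hg
  refine ext_coeff fun n => ?_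
  rw [map_add, coeff_C_mul, coeff_aeval_t]
  by_cases hn : n = 0
  · rw [hn, coeff_zero_aeval_t_mul_C, hg0, ZeroMemClass.coe_zero, mul_zero, zero_add, coeff_C_zero]
  · rw [← coeff_zero_hasse, hasse_mul_C, hasse_aeval_t, hgj n hn, aeval_C, algebraMap_eq,
      ← map_mul, coeff_C_zero, coeff_C_of_ne_zero _ hn, add_zero, δ.constField_comm]

theorem aeval_t_sub_C_mem_center (hg : IsPPolynomial p g) {c : D}
    (hc : IsInnerBy (aeval δ.toEnd g) c) (hδc : δ c = 0) :
    aeval (t δ) g - C δ c ∈ Subring.center (DiffPoly δ) := by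
  refine mem_center_iff.mpr ⟨fun a => ?_, t_mul_eq_mul_t_iff.mpr fun n => ?_⟩
  · rw [sub_mul, aeval_t_mul_C hg, hc a, mul_sub, ← map_mul, ← map_mul, map_sub]
    abel
  · rw [map_sub, coeff_aeval_t, map_sub, (g.coeff n).2.2, coeff_C, apply_ite δ, hδc, map_zero,
      ite_self, sub_zero]

theorem _root_.IsMinPPolynomial.natDegree_pos (hg : IsMinPPolynomial p δ g) : 0 < g.natDegree :=
  Nat.pos_of_ne_zero fun h => hg.1.ne_zero <| by
    rw [eq_C_of_natDegree_eq_zero h, (isPPolynomial_iff.mp hg.2.1).1, map_zero]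

/- The Hasse derivatives of a central element of low degree are central of lower degree, hence
constant by induction; this forces the element to be a `p`-polynomial in `t` plus a constant. -/
theorem _root_.IsMinPPolynomial.degree_le_zero_of_mem_center (hg : IsMinPPolynomial p δ g)
    {u : DiffPoly δ} (hu : u ∈ Subring.center (DiffPoly δ)) (hdeg : degree u < g.natDegree) :
    degree u ≤ 0 := by
  suffices ∀ n ≤ g.natDegree, ∀ u ∈ Subring.center (DiffPoly δ), degree u < n → degree u ≤ 0 from
    this _ le_rfl u hu hdeg
  clear u hu hdeg
  intro n
  induction n with
  | zero => exact fun _ u _ hdeg => hdeg.le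
  | succ n ih =>
    intro hn u hu hdeg
    rw [degree_lt_iff_coeff_zero] at hdeg
    have hhasse (j : ℕ) (hj : j ≠ 0) : hasse j u = C δ (coeff j u) := by
      rw [← coeff_zero_hasse]
      refine eq_C_of_degree_le_zero (ih (by lia) _ (hasse_mem_center j hu) ?_)
      refine degree_lt_iff_coeff_zero.mpr fun i hi => ?_
      rw [coeff_hasse, hdeg _ (by lia), smul_zero]
    obtain ⟨q, hq0, hqu⟩ := exists_eq_aeval_t_add_C fun j hj =>
      C_mem_center_iff.mp (hhasse j hj ▸ hasse_mem_center j hu)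
    have hcoeff (j : ℕ) (hj : j ≠ 0) : coeff j u = (q.coeff j : D) := by
      rw [hqu, map_add, coeff_aeval_t, coeff_C_of_ne_zero _ hj, add_zero]
    have hqp : IsPPolynomial p q := isPPolynomial_iff.mpr ⟨hq0, fun j hj => aeval_t_injective <| by
      have h := hhasse j hj
      rwa [hcoeff j hj, hqu, map_add, hasse_aeval_t, hasse_C _ hj, add_zero, ← algebraMap_eq,
        ← aeval_C (t δ)] at h⟩
    have hq : q = 0 := by
      by_contra hq
      have hle := hg.natDegree_le hq hqp (isInnerBy_neg_of_mem_center hq0 (hqu ▸ hu))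
      refine leadingCoeff_ne_zero.mpr hq (Subtype.ext ?_)
      exact (hcoeff _ (by lia)).symm.trans (hdeg _ (by lia))
    rw [hqu, hq, map_zero, zero_add]
    exact degree_C_le _

theorem _root_.IsMinPPolynomial.degree_aeval_t_sub_C (hg : IsMinPPolynomial p δ g) (a : D) :
    degree (aeval (t δ) g - C δ a) = g.natDegree := by
  have hcoeff (n : ℕ) (hn : n ≠ 0) : coeff n (aeval (t δ) g - C δ a) = (g.coeff n : D) := by
    rw [map_sub, coeff_aeval_t, coeff_C_of_ne_zero _ hn, sub_zero]
  have hpos := hg.natDegree_pos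
  refine degree_eq_of_le_of_coeff_ne_zero (degree_le_iff_coeff_zero.mpr fun n hn => ?_) ?_
  · rw [hcoeff n (by lia), coeff_eq_zero_of_natDegree_lt hn, ZeroMemClass.coe_zero]
  · rw [hcoeff _ hpos.ne', hg.1.coeff_natDegree]
    exact one_ne_zero

theorem _root_.IsMinPPolynomial.degree_aeval_t_sub_C_pos (hg : IsMinPPolynomial p δ g) (a : D) :
    0 < degree (aeval (t δ) g - C δ a) := by
  rw [hg.degree_aeval_t_sub_C]
  exact Nat.cast_pos.mpr hg.natDegree_pos

end PPolynomial

end DiffPoly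

theorem isTwoSided_span_singleton_of_mem_center {R : Type*} [Ring R] {z : R}
    (hz : z ∈ Subring.center R) : (Ideal.span {z}).IsTwoSided where
  mul_mem_of_left b h := by
    obtain ⟨r, rfl⟩ := Ideal.mem_span_singleton'.mp h
    exact Ideal.mem_span_singleton'.mpr
      ⟨r * b, by rw [mul_assoc, Subring.mem_center_iff.mp hz, mul_assoc]⟩

namespace DiffPoly

section DivisionRing

variable {D : Type*} [DivisionRing D] {δ : RingDerivation D}

theorem exists_degree_sub_mul_lt (q : DiffPoly δ) {u : DiffPoly δ} (hu : u ≠ 0) :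
    ∃ s, degree (q - s * u) < degree u := by
  obtain ⟨s, -, hs⟩ := (InvImage.wf (fun s => degree (q - s * u)) wellFounded_lt).has_min
    Set.univ ⟨0, trivial⟩
  refine ⟨s, lt_of_not_ge fun h => ?_⟩
  have hq : q - s * u ≠ 0 := fun hq => by
    rw [hq, degree_eq_bot.mpr rfl, le_bot_iff, degree_eq_bot] at h
    exact hu h
  obtain ⟨n, hn, hn0⟩ := exists_degree_eq hu
  obtain ⟨m, hm, -⟩ := exists_degree_eq hq
  obtain ⟨k, rfl⟩ := Nat.exists_eq_add_of_le' (Nat.cast_le.mp (hn ▸ hm ▸ h))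
  set a := coeff (k + n) (q - s * u) * (coeff n u)⁻¹ with ha
  have hle : degree (C δ a * t δ ^ k) ≤ k := by
    rw [C_mul_t_pow]
    exact Polynomial.degree_monomial_le k a
  have hcoeff : coeff k (C δ a * t δ ^ k) = a := by
    rw [C_mul_t_pow]
    exact Polynomial.coeff_monomial_same k a
  refine hs (s + C δ a * t δ ^ k) trivial ?_
  change degree (q - (s + C δ a * t δ ^ k) * u) < degree (q - s * u)
  rw [add_mul, ← sub_sub, hm]
  refine degree_lt_of_le_of_coeff_eq_zero
    ((degree_sub_le _ _).trans (max_le hm.le (degree_mul_le_of_le hle hn.le))) ?_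
  rw [map_sub, coeff_mul_of_degree_le hle hn.le, hcoeff, ha, inv_mul_cancel_right₀ hn0, sub_self]

-- A monic element of least degree is central: its commutators lie in `I` and have lower degree.
theorem exists_mem_center_forall_degree_le {I : TwoSidedIdeal (DiffPoly δ)} (hI : I ≠ ⊥) :
    ∃ u ∈ I, u ∈ Subring.center (DiffPoly δ) ∧ u ≠ 0 ∧ ∀ v ∈ I, v ≠ 0 → degree u ≤ degree v := by
  obtain ⟨v, hv, hv0⟩ := SetLike.exists_of_lt (bot_lt_iff_ne_bot.mpr hI)
  obtain ⟨w, ⟨hw, hw0⟩, hmin⟩ := (InvImage.wf degree wellFounded_lt).has_min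
    {u | u ∈ I ∧ u ≠ 0} ⟨v, hv, hv0⟩
  obtain ⟨n, hn, hn0⟩ := exists_degree_eq hw0
  have hzero {v : DiffPoly δ} (hv : v ∈ I) (hvn : degree v < n) : v = 0 :=
    of_not_not fun h => hmin v ⟨hv, h⟩ (hvn.trans_eq hn.symm)
  obtain ⟨u, huI, hun, hu1⟩ : ∃ u ∈ I, degree u ≤ n ∧ coeff n u = 1 :=
    ⟨C δ (coeff n w)⁻¹ * w, I.mul_mem_left _ _ hw,
      by simpa only [zero_add] using degree_mul_le_of_le (m := 0) (degree_C_le _) hn.le,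
      by rw [coeff_C_mul, inv_mul_cancel₀ hn0]⟩
  refine ⟨u, huI, mem_center_iff.mpr ⟨fun a => sub_eq_zero.mp (hzero
    (sub_mem (I.mul_mem_left _ _ huI) (I.mul_mem_right _ _ huI)) ?_), sub_eq_zero.mp (hzero
    (sub_mem (I.mul_mem_left _ _ huI) (I.mul_mem_right _ _ huI)) ?_)⟩, ?_, fun v hv hv0 => ?_⟩
  · refine degree_lt_of_le_of_coeff_eq_zero ((degree_C_mul_sub_mul_C_le a u).trans hun) ?_
    rw [map_sub, coeff_C_mul, ← add_zero n, coeff_mul_of_degree_le (n := 0) hun (degree_C_le a),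
      add_zero, hu1, coeff_C_zero, mul_one, one_mul, sub_self]
  · refine degree_lt_of_le_of_coeff_eq_zero ((degree_t_mul_sub_mul_t_le u).trans hun) ?_
    rw [coeff_t_mul_sub_mul_t, hu1, δ.map_one]
  · rintro rfl
    rw [map_zero] at hu1
    exact zero_ne_one hu1
  · exact hun.trans (hn.ge.trans (not_lt.mp (hmin v ⟨hv, hv0⟩)))

section Quotient

variable {z : DiffPoly δ} [(Ideal.span {z}).IsTwoSided]

theorem exists_degree_lt_mk_eq (hz : z ≠ 0) (x : DiffPoly δ ⧸ Ideal.span {z}) :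
    ∃ u, degree u < degree z ∧ Ideal.Quotient.mk _ u = x := by
  obtain ⟨q, rfl⟩ := Ideal.Quotient.mk_surjective x
  obtain ⟨s, hs⟩ := exists_degree_sub_mul_lt q hz
  refine ⟨_, hs, Ideal.Quotient.mk_eq_mk_iff_sub_mem _ _ |>.mpr ?_⟩
  rw [sub_sub_cancel_left]
  exact neg_mem (Ideal.mem_span_singleton'.mpr ⟨s, rfl⟩)

theorem finite_quotient [Module.Finite δ.constField D] (hz : z ≠ 0) :
    Module.Finite δ.constField (DiffPoly δ ⧸ Ideal.span {z}) := by
  obtain ⟨n, hn, -⟩ := exists_degree_eq hz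
  let ψ : (Fin n → D) →ₗ[δ.constField] DiffPoly δ :=
    { toFun v := ∑ i, C δ (v i) * t δ ^ (i : ℕ)
      map_add' v w := by simp only [Pi.add_apply, map_add, add_mul, Finset.sum_add_distrib]
      map_smul' a v := by
        simp only [Algebra.smul_def, algebraMap_eq, Finset.mul_sum, ← mul_assoc, ← map_mul,
          RingHom.id_apply]
        rfl }
  refine .of_surjective ((Ideal.Quotient.mkₐ _ (Ideal.span {z})).toLinearMap ∘ₗ ψ) fun x => ?_
  obtain ⟨u, hu, rfl⟩ := exists_degree_lt_mk_eq hz x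
  refine ⟨fun i => coeff i u, congrArg (Ideal.Quotient.mk _) ?_⟩
  change ∑ i : Fin n, C δ (coeff i u) * t δ ^ (i : ℕ) = u
  simp only [C_mul_t_pow]
  exact (Polynomial.sum_fin (R := D) _ Polynomial.monomial_zero_right (hu.trans_eq hn)).trans
    (Polynomial.sum_monomial_eq (R := D) u)

theorem isSimpleRing_quotient (hz : 0 < degree z)
    (hcen : ∀ u ∈ Subring.center (DiffPoly δ), degree u < degree z → degree u ≤ 0) :
    IsSimpleRing (DiffPoly δ ⧸ Ideal.span {z}) := by
  have hz0 : z ≠ 0 := ne_zero_of_degree_pos hz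
  have := Ideal.Quotient.nontrivial_iff.mpr ((Ideal.ne_top_iff_one _).mpr (one_notMem_span hz))
  refine .of_eq_bot_or_eq_top fun T => ?_
  set I := T.comap (Ideal.Quotient.mk (Ideal.span {z}))
  have hmem {u : DiffPoly δ} : u ∈ I ↔ Ideal.Quotient.mk (Ideal.span {z}) u ∈ T :=
    TwoSidedIdeal.mem_comap _
  have hzI : z ∈ I := hmem.mpr <| by
    rw [Ideal.Quotient.eq_zero_iff_mem.mpr (Ideal.mem_span_singleton_self z)]
    exact zero_mem T
  obtain ⟨u, huI, huc, hu0, hmin⟩ := exists_mem_center_forall_degree_le (I := I)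
    fun h => hz0 ((TwoSidedIdeal.mem_bot _).mp (h ▸ hzI))
  obtain hlt | hle := (hmin z hzI hz0).lt_or_eq
  · right
    have hu := eq_C_of_degree_le_zero (hcen u huc hlt)
    have hu0' : coeff 0 u ≠ 0 := fun h => hu0 (by rw [hu, h, map_zero])
    have h1 := hmem.mp (I.mul_mem_left (C δ (coeff 0 u)⁻¹) _ (hu ▸ huI))
    rwa [← map_mul, inv_mul_cancel₀ hu0', map_one, map_one, TwoSidedIdeal.one_mem_iff] at h1
  · left
    refine eq_bot_iff.mpr fun x hx => ?_
    obtain ⟨v, hv, rfl⟩ := exists_degree_lt_mk_eq hz0 x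
    have hv0 : v = 0 := of_not_not fun h => hv.not_ge (hle ▸ hmin v (hmem.mpr hx) h)
    rw [hv0, map_zero]
    exact zero_mem _

theorem isCentral_quotient (hz : z ≠ 0)
    (hcen : ∀ u ∈ Subring.center (DiffPoly δ), degree u < degree z → degree u ≤ 0) :
    Algebra.IsCentral δ.constField (DiffPoly δ ⧸ Ideal.span {z}) where
  out x hx := by
    obtain ⟨u, hdeg, rfl⟩ := exists_degree_lt_mk_eq hz x
    have hcomm (v : DiffPoly δ) : v * u - u * v ∈ Ideal.span {z} := by
      rw [← Ideal.Quotient.eq_zero_iff_mem, map_sub, map_mul, map_mul,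
        Subalgebra.mem_center_iff.mp hx, sub_self]
    have hu : u ∈ Subring.center (DiffPoly δ) := mem_center_iff.mpr
      ⟨fun a => sub_eq_zero.mp <| eq_zero_of_mem_span_of_degree_lt (hcomm _) <|
          (degree_C_mul_sub_mul_C_le a u).trans_lt hdeg,
        sub_eq_zero.mp <| eq_zero_of_mem_span_of_degree_lt (hcomm _) <|
          (degree_t_mul_sub_mul_t_le u).trans_lt hdeg⟩
    have huC := eq_C_of_degree_le_zero (hcen u hu hdeg)
    rw [huC] at hu ⊢
    exact ⟨⟨_, C_mem_center_iff.mp hu⟩, rfl⟩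

end Quotient

theorem isGeneralisedAPolynomial_of_rightDvd [Module.Finite δ.constField D] {f z : DiffPoly δ}
    (hz : z ∈ Subring.center (DiffPoly δ)) (hz0 : 0 < degree z)
    (hcen : ∀ u ∈ Subring.center (DiffPoly δ), degree u < degree z → degree u ≤ 0)
    (hfz : f ∣ᵣ z) (hf : ¬ f ∣ᵣ 1) : IsGeneralisedAPolynomial f := by
  have hne : z ≠ 0 := ne_zero_of_degree_pos hz0
  have := isTwoSided_span_singleton_of_mem_center hz
  have := isSimpleRing_quotient hz0 hcen
  have := isCentral_quotient hne hcen
  have := finite_quotient hne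
  have := IsSimpleRing.isSemisimpleRing_iff_isArtinianRing.mpr
    (IsArtinianRing.of_finite δ.constField (DiffPoly δ ⧸ Ideal.span {z}))
  refine isSimpleRing_isCentral_finite_eigenring (Ideal.Quotient.mkₐ δ.constField (Ideal.span {z}))
    (Ideal.Quotient.mkₐ_surjective _ _) (fun q hq => ?_) hf
  obtain ⟨s, rfl⟩ := Ideal.mem_span_singleton'.mp (Ideal.Quotient.eq_zero_iff_mem.mp hq)
  exact hfz.mul_left s

theorem exists_rightDvd_sub_of_isCentral {f z : DiffPoly δ}
    (hz : z ∈ Subring.center (DiffPoly δ))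
    (hf : Algebra.IsCentral δ.constField (Eigenring δ.constField f)) :
    ∃ b : δ.constField, f ∣ᵣ z - C δ (b : D) := by
  have hzc := Subring.mem_center_iff.mp hz
  let x : idealiser δ.constField f := ⟨z, z, hzc f⟩
  have hx : Ideal.Quotient.mk (idealiserIdeal δ.constField f) x ∈
      Subalgebra.center δ.constField (Eigenring δ.constField f) :=
    Subalgebra.mem_center_iff.mpr <| Ideal.Quotient.mk_surjective.forall.mpr fun y =>
      congrArg _ (Subtype.ext (hzc y))
  obtain ⟨b, hb⟩ := hf.out hx
  exact ⟨b, (Ideal.Quotient.eq (x := x) (y := algebraMap _ _ b)).mp hb.symm⟩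

theorem transcendental_of_degree_pos {z : DiffPoly δ} (hz : 0 < degree z) :
    Transcendental δ.constField z := fun h => by
  have : IsDomain (DiffPoly δ) := NoZeroDivisors.to_isDomain _
  obtain ⟨u, rfl⟩ := h.isIntegral.isUnit (ne_zero_of_degree_pos hz)
  exact one_notMem_span hz (Ideal.mem_span_singleton'.mpr ⟨↑u⁻¹, u.inv_mul⟩)

theorem _root_.IsMinimalCentralLeftMultiple.not_isUnit {f h : DiffPoly δ}
    (hfh : IsMinimalCentralLeftMultiple f h) (hh : Transcendental δ.constField h) :
    ¬ IsUnit f := by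
  rintro ⟨u, rfl⟩
  obtain ⟨-, hcen, -, hmin⟩ := hfh
  have hdeg : degree h ≤ 0 :=
    (hmin 1 one_ne_zero (one_mem _) ⟨↑u⁻¹, u.inv_mul.symm⟩).trans degree_one_le
  have hC := eq_C_of_degree_le_zero hdeg
  rw [hC, C_mem_center_iff] at hcen
  rw [hC] at hh
  exact hh (isAlgebraic_algebraMap (⟨_, hcen⟩ : δ.constField))

end DivisionRing

end DiffPoly

theorem theorem4_general {D : Type*} [DivisionRing D] [Module.Finite (Subring.center D) D]
    (p : ℕ) [Fact p.Prime] [CharP (Subring.center D) p]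
    (δ : RingDerivation D) (g : (δ.constField)[X]) (hg : IsMinPPolynomial p δ g)
    (c : D) (hc : IsInnerBy (aeval δ.toEnd g) c) (hδc : δ c = 0)
    (f : DiffPoly δ) (hf : ¬ IsUnit f) :
    (IsGeneralisedAPolynomial f ↔
      ∃ b : δ.constField,
        f ∣ᵣ aeval (DiffPoly.t δ) g - DiffPoly.C δ ((b : D) + c)) ∧
    (IsGeneralisedAPolynomial f → f.degree ≤ (g.natDegree : WithBot ℕ)) := by
  have hz := DiffPoly.aeval_t_sub_C_mem_center hg.2.1 hc hδc
  have hsplit (b : δ.constField) : aeval (DiffPoly.t δ) g - DiffPoly.C δ ((b : D) + c) =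
      aeval (DiffPoly.t δ) g - DiffPoly.C δ c - DiffPoly.C δ (b : D) := by
    rw [map_add, sub_sub, add_comm]
  have hdvd (h : IsGeneralisedAPolynomial f) : ∃ b : δ.constField,
      f ∣ᵣ aeval (DiffPoly.t δ) g - DiffPoly.C δ ((b : D) + c) := by
    simpa only [hsplit] using DiffPoly.exists_rightDvd_sub_of_isCentral hz h.2.1
  refine ⟨⟨hdvd, fun ⟨b, hb⟩ => ?_⟩, fun h => ?_⟩
  · have := RingDerivation.finite_of_isInnerBy hg.1 hc
    have hdeg := hg.degree_aeval_t_sub_C ((b : D) + c)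
    refine DiffPoly.isGeneralisedAPolynomial_of_rightDvd ?_ (hg.degree_aeval_t_sub_C_pos _)
      (fun u hu hlt => hg.degree_le_zero_of_mem_center hu (hdeg ▸ hlt)) hb fun ⟨s, hs⟩ =>
        hf (.of_mul_eq_one_right s hs.symm)
    exact hsplit b ▸ sub_mem hz (DiffPoly.C_mem_center_iff.mpr b.2)
  · obtain ⟨b, hb⟩ := hdvd h
    rw [← hg.degree_aeval_t_sub_C ((b : D) + c)]
    exact DiffPoly.degree_le_of_rightDvd
      (DiffPoly.ne_zero_of_degree_pos (hg.degree_aeval_t_sub_C_pos _)) hb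

end

theorem theorem4 {D : Type*} [DivisionRing D] [Module.Finite (Subring.center D) D]
    (p : ℕ) [Fact p.Prime] [CharP (Subring.center D) p]
    (δ : RingDerivation D) (g : (δ.constField)[X]) (e : ℕ)
    (hg : IsMinPPolynomial p δ g) (hge : g.natDegree = p ^ e)
    (c : D) (hc : IsInnerBy (aeval δ.toEnd g) c) (hδc : δ c = 0)
    (f : DiffPoly δ) (hhat : (δ.constField)[X]) (hmonic : hhat.Monic)
    (hmin : IsMinimalCentralLeftMultiple f
      (aeval (aeval (DiffPoly.t δ) g - DiffPoly.C δ c) hhat))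
    (hirr : Irreducible hhat) :
    (IsGeneralisedAPolynomial f ↔
      ∃ b : δ.constField,
        f ∣ᵣ aeval (DiffPoly.t δ) g - DiffPoly.C δ ((b : D) + c)) ∧
    (IsGeneralisedAPolynomial f → f.degree ≤ ((p ^ e : ℕ) : WithBot ℕ)) := by
  have hh := (DiffPoly.transcendental_of_degree_pos (hg.degree_aeval_t_sub_C_pos c)).aeval hhat
    hirr.natDegree_pos.ne' (mem_nonZeroDivisors_of_ne_zero (leadingCoeff_ne_zero.mpr hirr.ne_zero))
  exact hge ▸ theorem4_general p δ g hg c hc hδc f (hmin.not_isUnit hh)
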